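/- Identify $\mathbb{R}^{2n}$ with $\mathbb{C}^n$, writing $x=(x_{11},x_{12},\ldots,x_{n1},x_{n2})$, and for $\theta\in\mathbb{R}$ let $R_\theta$ act on $\mathbb{R}^{2n}$ by rotating each pair $(x_{i1},x_{i2})$ counterclockwise by the angle $\theta$. For a convex body $L$ (a compact convex set with nonempty interior) that is origin symmetric ($L=-L$), let $\|x\|_L=\min\{a\ge 0: x\in aL\}$ be its Minkowski functional, and let $|\cdot|_2$ be the Euclidean norm. The body $L$ is infinitely smooth if the restriction of $\|\cdot\|_L$ to the unit sphere $S^{2n-1}$ is $C^\infty$; it has positive curvature if at every boundary point the second fundamental form with respect to the outer unit normal is positive definite (all principal curvatures are strictly positive); it is invariant under all $R_\theta$ if $\|R_\theta x\|_L=\|x\|_L$ for all $\theta$ and $x$. A tempered distribution $T$ on $\mathbb{R}^{2n}$ is positive definite if $\langle T,\phi*\overline{\phi(-\,\cdot)}\rangle\ge 0$ for every Schwartz function $\phi$. **Lemma.** Let $n\ge 3$ be an integer and let $\alpha\in(2n-7,2n-6)$. There exists an infinitely smooth origin symmetric convex body $L$ in $\mathbb{R}^{2n}$ with positive curvature, invariant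 under all $R_\theta$, such that the function $$x\longmapsto |x|_2^{-\alpha}\,\|x\|_L^{-2}$$ defines a tempered distribution by integration (its product with every Schwartz function is integrable) and this distribution is not positive definite. -/

import Mathlib

open scoped SchwartzMap ContDiff Manifold ComplexOrder Gradient

noncomputable section

namespace ComplexBP

/-- `ℝ^{2n}`, with the coordinates of `x` written `x_{i j}`, `i = 1, …, n`, `j = 1, 2`,
and with the Euclidean norm. It is `ℂ^n` under `z_i = x_{i1} + i x_{i2}`. -/
abbrev Space (n : ℕ) : Type := EuclideanSpace ℝ (Fin n × Fin 2)

/-- The coordinate-wise counterclockwise rotation by the angle `θ`: every pair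
`(x_{i1}, x_{i2})` is rotated by `θ` in its plane. -/
def rotate {n : ℕ} (θ : ℝ) (x : Space n) : Space n :=
  WithLp.toLp 2 fun p =>
    if p.2 = 0 then Real.cos θ * x (p.1, 0) - Real.sin θ * x (p.1, 1)
    else Real.sin θ * x (p.1, 0) + Real.cos θ * x (p.1, 1)

/-- Invariance with respect to all `R_θ`: `‖R_θ x‖_K = ‖x‖_K` for the Minkowski functional
`‖·‖_K = gauge K`. -/
def IsRotationInvariant {n : ℕ} (K : Set (Space n)) : Prop :=
  ∀ (θ : ℝ) (x : Space n), gauge K (rotate θ x) = gauge K x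

section Body

variable {E : Type*} [NormedAddCommGroup E] [InnerProductSpace ℝ E]

/-- An origin symmetric convex body: convex, compact, with interior points, and `K = -K`. -/
structure IsSymmetricConvexBody (K : Set E) : Prop where
  convex : Convex ℝ K
  isCompact : IsCompact K
  interior_nonempty : (interior K).Nonempty
  symmetric : ∀ x ∈ K, -x ∈ K

/-- Infinite smoothness: the restriction of the Minkowski functional to the unit sphere is a
`C^∞` function on the sphere (`m + 1` is the dimension of the space). -/
def IsInfinitelySmooth (K : Set E) : Prop :=
  ∀ (m : ℕ) [Fact (Module.finrank ℝ E = m + 1)],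
    ContMDiff (𝓡 m) 𝓘(ℝ, ℝ) ∞ (fun x : Metric.sphere (0 : E) 1 => gauge K (x : E))

variable [CompleteSpace E]

/-- The outer unit normal field of the level sets of the Minkowski functional; on the boundary
`{‖x‖_K = 1}` of `K` it is the Gauss map of the boundary. -/
def outerNormal (K : Set E) (x : E) : E :=
  ‖∇ (gauge K) x‖⁻¹ • ∇ (gauge K) x

/-- The second fundamental form `(v, w) ↦ ⟨dν_x v, w⟩` of the boundary of `K` at `x`. -/
def secondFundamentalForm (K : Set E) (x v w : E) : ℝ :=
  inner ℝ (fderiv ℝ (outerNormal K) x v) w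

/-- Positive curvature: at every boundary point the second fundamental form is positive definite
on the tangent space, i.e. all principal curvatures are strictly positive. -/
def HasPositiveCurvature (K : Set E) : Prop :=
  ∀ x ∈ frontier K, ∀ v : E, v ≠ 0 → inner ℝ (outerNormal K x) v = 0 →
    0 < secondFundamentalForm K x v v

end Body

section Distribution

/-- The Schwartz function `x ↦ conj (φ (-x))`. -/
def conjReflect {E : Type*} [NormedAddCommGroup E] [InnerProductSpace ℝ E]
    (φ : 𝓢(E, ℂ)) : 𝓢(E, ℂ) :=
  SchwartzMap.postcompCLM (𝕜 := ℝ) (Complex.conjCLE : ℂ →L[ℝ] ℂ)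
    (SchwartzMap.compCLMOfContinuousLinearEquiv ℝ
      (LinearIsometryEquiv.neg ℝ (E := E)).toContinuousLinearEquiv φ)

theorem conjReflect_apply {E : Type*} [NormedAddCommGroup E] [InnerProductSpace ℝ E]
    (φ : 𝓢(E, ℂ)) (x : E) :
    conjReflect φ x = (starRingEnd ℂ) (φ (-x)) := rfl

variable {E : Type*} [NormedAddCommGroup E] [InnerProductSpace ℝ E] [FiniteDimensional ℝ E]
  [MeasurableSpace E] [BorelSpace E]

/-- The tempered distribution `T` is the function `f`: `f φ` is integrable and
`⟨T, φ⟩ = ∫ f φ` for every Schwartz function `φ`. -/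
def IsGivenBy (T : 𝓢'(E, ℂ)) (f : E → ℝ) : Prop :=
  ∀ φ : 𝓢(E, ℂ), MeasureTheory.Integrable (fun x => (f x : ℂ) * φ x) ∧
    T φ = ∫ x, (f x : ℂ) * φ x

/-- A tempered distribution `T` is positive definite if `⟨T, φ ∗ conj φ(-·)⟩` is a non-negative
real number for every Schwartz function `φ`. -/
def IsPositiveDefinite (T : 𝓢'(E, ℂ)) : Prop :=
  ∀ φ : 𝓢(E, ℂ),
    0 ≤ T (SchwartzMap.convolution (ContinuousLinearMap.mul ℂ ℂ) φ (conjReflect φ))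

end Distribution

end ComplexBP

end

namespace ComplexBP

section QuarticBody

open scoped Pointwise

variable {E F : Type*} [NormedAddCommGroup E] [InnerProductSpace ℝ E]
  [NormedAddCommGroup F] [InnerProductSpace ℝ F]

/-- The quartic form `‖x‖⁴ + M ‖A x‖⁴`. -/
def quarticForm (M : ℝ) (A : E →L[ℝ] F) (x : E) : ℝ := ‖x‖ ^ 4 + M * ‖A x‖ ^ 4

/-- The sublevel set of the quartic form `‖x‖⁴ + M ‖A x‖⁴`. -/
def quarticBody (M : ℝ) (A : E →L[ℝ] F) : Set E := {x | quarticForm M A x ≤ 1}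

variable {M : ℝ} {A : E →L[ℝ] F}

theorem contDiff_quarticForm : ContDiff ℝ ∞ (quarticForm M A) := by
  have h (x : E) : quarticForm M A x = (‖x‖ ^ 2) ^ 2 + M * (‖A x‖ ^ 2) ^ 2 := by
    simp only [quarticForm]; ring
  rw [funext h]
  have h1 : ContDiff ℝ ∞ fun x : E => ‖x‖ ^ 2 := contDiff_norm_sq ℝ
  have h2 : ContDiff ℝ ∞ fun x : E => ‖A x‖ ^ 2 := A.contDiff.norm_sq ℝ
  fun_prop

theorem norm_pow_four_le_quarticForm (hM : 0 ≤ M) (x : E) : ‖x‖ ^ 4 ≤ quarticForm M A x := by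
  simp only [quarticForm]
  have : 0 ≤ M * ‖A x‖ ^ 4 := by positivity
  linarith

theorem quarticForm_nonneg (hM : 0 ≤ M) (x : E) : 0 ≤ quarticForm M A x :=
  (by positivity : (0 : ℝ) ≤ ‖x‖ ^ 4).trans (norm_pow_four_le_quarticForm hM x)

theorem quarticForm_pos (hM : 0 ≤ M) {x : E} (hx : x ≠ 0) : 0 < quarticForm M A x :=
  (pow_pos (norm_pos_iff.2 hx) 4).trans_le (norm_pow_four_le_quarticForm hM x)

theorem quarticForm_smul (c : ℝ) (x : E) :
    quarticForm M A (c • x) = c ^ 4 * quarticForm M A x := by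
  simp only [quarticForm, map_smul, norm_smul, mul_pow, Real.norm_eq_abs,
    Even.pow_abs (by decide : Even 4)]
  ring

theorem mem_smul_quarticBody {r : ℝ} (hr : 0 < r) (x : E) :
    x ∈ r • quarticBody M A ↔ quarticForm M A x ≤ r ^ 4 := by
  rw [Set.mem_smul_set_iff_inv_smul_mem₀ hr.ne', quarticBody, Set.mem_ofPred_eq, quarticForm_smul,
    inv_pow, inv_mul_le_iff₀ (by positivity), mul_one]

theorem gauge_quarticBody (hM : 0 ≤ M) (x : E) :
    gauge (quarticBody M A) x = quarticForm M A x ^ (1 / 4 : ℝ) := by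
  have hP := quarticForm_nonneg (A := A) hM x
  have key {r : ℝ} (hr : 0 < r) :
      x ∈ r • quarticBody M A ↔ quarticForm M A x ^ (1 / 4 : ℝ) ≤ r := by
    rw [mem_smul_quarticBody hr, ← Real.rpow_le_rpow_iff (z := 1 / 4) hP (by positivity)
      (by norm_num), ← Real.rpow_natCast, ← Real.rpow_mul hr.le]
    norm_num
  refine le_antisymm (le_of_forall_pos_le_add fun δ hδ => ?_) ?_
  · have h0 : 0 < quarticForm M A x ^ (1 / 4 : ℝ) + δ := by positivity
    exact gauge_le_of_mem h0.le ((key h0).2 (by linarith))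
  · rw [gauge_def]
    refine le_csInf ⟨quarticForm M A x ^ (1 / 4 : ℝ) + 1, ?_⟩ fun r hr => (key hr.1).1 hr.2
    have h0 : 0 < quarticForm M A x ^ (1 / 4 : ℝ) + 1 := by positivity
    exact ⟨h0, (key h0).2 (by linarith)⟩

theorem zero_mem_interior_quarticBody : (0 : E) ∈ interior (quarticBody M A) := by
  refine mem_interior.2 ⟨{x | quarticForm M A x < 1}, fun x hx => le_of_lt (α := ℝ) hx,
    isOpen_lt contDiff_quarticForm.continuous continuous_const, ?_⟩
  simp [quarticForm]

theorem isSymmetricConvexBody_quarticBody [FiniteDimensional ℝ E] (hM : 0 ≤ M) :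
    IsSymmetricConvexBody (quarticBody M A) where
  convex := by
    have h1 : ConvexOn ℝ Set.univ fun x : E => ‖x‖ ^ 4 :=
      convexOn_univ_norm.pow (fun _ _ => norm_nonneg _) 4
    have h2 : ConvexOn ℝ Set.univ fun x : E => ‖A x‖ ^ 4 :=
      (convexOn_univ_norm.comp_linearMap A.toLinearMap).pow (fun _ _ => norm_nonneg _) 4
    have h3 : ConvexOn ℝ Set.univ (quarticForm M A) := h1.add (h2.smul hM)
    simpa [quarticBody] using h3.convex_le 1
  isCompact := by
    refine Metric.isCompact_of_isClosed_isBounded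
      (isClosed_le contDiff_quarticForm.continuous continuous_const)
      (Metric.isBounded_closedBall (x := (0 : E)) (r := 1) |>.subset fun x hx => ?_)
    rw [mem_closedBall_zero_iff]
    have := (norm_pow_four_le_quarticForm hM x).trans hx
    by_contra! h
    exact absurd this (not_le.2 (one_lt_pow₀ h (by norm_num)))
  interior_nonempty := ⟨0, zero_mem_interior_quarticBody⟩
  symmetric x hx := by
    simpa [quarticBody, quarticForm] using hx

theorem contDiffAt_gauge_quarticBody (hM : 0 ≤ M) {x : E} (hx : x ≠ 0) :
    ContDiffAt ℝ ∞ (gauge (quarticBody M A)) x := by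
  rw [funext (gauge_quarticBody hM)]
  exact contDiff_quarticForm.contDiffAt.rpow_const_of_ne (quarticForm_pos hM hx).ne'

theorem isInfinitelySmooth_quarticBody (hM : 0 ≤ M) : IsInfinitelySmooth (quarticBody M A) := by
  intro m _ x
  have hx : (x : E) ≠ 0 := fun h => by simpa [h] using x.2
  exact (contDiffAt_gauge_quarticBody (A := A) hM hx).contMDiffAt.comp x
    (contMDiff_coe_sphere (n := m) (m := ∞)).contMDiffAt

variable [CompleteSpace E] [CompleteSpace F]

/-- A quarter of the gradient of the quartic form. -/
noncomputable def quarticGradient (M : ℝ) (A : E →L[ℝ] F) (x : E) : E :=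
  ‖x‖ ^ 2 • x + (M * ‖A x‖ ^ 2) • A.adjoint (A x)

theorem inner_quarticGradient (x v : E) : inner ℝ (quarticGradient M A x) v =
    ‖x‖ ^ 2 * inner ℝ x v + M * ‖A x‖ ^ 2 * inner ℝ (A x) (A v) := by
  simp [quarticGradient, inner_add_left, real_inner_smul_left,
    ContinuousLinearMap.adjoint_inner_left]

theorem hasFDerivAt_quarticForm (x : E) :
    HasFDerivAt (quarticForm M A) ((4 : ℝ) • innerSL ℝ (quarticGradient M A x)) x := by
  have h1 : HasFDerivAt (fun x : E => ‖x‖ ^ 2) _ x := (hasFDerivAt_id x).norm_sq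
  have h2 : HasFDerivAt (fun x : E => ‖A x‖ ^ 2) _ x := A.hasFDerivAt.norm_sq
  have h3 := (h1.pow 2).add ((h2.pow 2).const_mul M)
  have e : quarticForm M A = (fun x => (‖x‖ ^ 2) ^ 2 + M * (‖A x‖ ^ 2) ^ 2) := by
    ext x; simp only [quarticForm]; ring
  rw [e]
  refine h3.congr_fderiv ?_
  ext v
  simp [inner_quarticGradient]
  ring

theorem gradient_gauge_quarticBody (hM : 0 ≤ M) {x : E} (hx : x ≠ 0) :
    ∃ c : ℝ, 0 < c ∧ ∇ (gauge (quarticBody M A)) x = c • quarticGradient M A x := by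
  have hP := quarticForm_pos (A := A) hM hx
  refine ⟨(1 / 4) * quarticForm M A x ^ (1 / 4 - 1 : ℝ) * 4, by positivity, ?_⟩
  have h := (hasFDerivAt_quarticForm (M := M) (A := A) x).rpow_const (p := 1 / 4) (Or.inl hP.ne')
  apply HasGradientAt.gradient
  rw [funext (gauge_quarticBody hM), hasGradientAt_iff_hasFDerivAt]
  refine h.congr_fderiv ?_
  ext v
  simp
  ring

theorem quarticGradient_ne_zero (hM : 0 ≤ M) {x : E} (hx : x ≠ 0) :
    quarticGradient M A x ≠ 0 := by
  intro h
  have h1 := inner_quarticGradient (M := M) (A := A) x x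
  rw [h, inner_zero_left, real_inner_self_eq_norm_sq, real_inner_self_eq_norm_sq] at h1
  have h2 : 0 < ‖x‖ ^ 2 * ‖x‖ ^ 2 := by
    have := norm_pos_iff.2 hx
    positivity
  have h3 : 0 ≤ M * ‖A x‖ ^ 2 * ‖A x‖ ^ 2 := by positivity
  linarith

theorem outerNormal_quarticBody (hM : 0 ≤ M) {x : E} (hx : x ≠ 0) :
    outerNormal (quarticBody M A) x = ‖quarticGradient M A x‖⁻¹ • quarticGradient M A x := by
  obtain ⟨c, hc, h⟩ := gradient_gauge_quarticBody (A := A) hM hx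
  rw [outerNormal, h, norm_smul, Real.norm_of_nonneg hc.le, smul_smul, mul_inv]
  congr 1
  field_simp

/-- The derivative of `quarticGradient`. -/
theorem hasFDerivAt_quarticGradient (x : E) : ∃ D : E →L[ℝ] E,
    HasFDerivAt (quarticGradient M A) D x ∧ ∀ v, inner ℝ (D v) v =
      ‖x‖ ^ 2 * ‖v‖ ^ 2 + 2 * inner ℝ x v ^ 2 +
        M * (‖A x‖ ^ 2 * ‖A v‖ ^ 2 + 2 * inner ℝ (A x) (A v) ^ 2) := by
  have h1 : HasFDerivAt (fun x : E => ‖x‖ ^ 2) _ x := (hasFDerivAt_id x).norm_sq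
  have h2 : HasFDerivAt (fun x : E => ‖A x‖ ^ 2) _ x := A.hasFDerivAt.norm_sq
  have h3 : HasFDerivAt (fun x : E => A.adjoint (A x)) _ x :=
    (A.adjoint.comp A).hasFDerivAt
  refine ⟨_, (h1.smul (hasFDerivAt_id x)).add ((h2.const_mul M).smul h3), fun v => ?_⟩
  simp [inner_add_left, real_inner_smul_left, ContinuousLinearMap.adjoint_inner_left]
  ring

theorem hasPositiveCurvature_quarticBody (hM : 0 ≤ M) :
    HasPositiveCurvature (quarticBody M A) := by
  intro x hx v hv hnv
  have hx0 : x ≠ 0 := by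
    rintro rfl
    exact hx.2 zero_mem_interior_quarticBody
  have hG := quarticGradient_ne_zero (A := A) hM hx0
  obtain ⟨D, hD, hDv⟩ := hasFDerivAt_quarticGradient (M := M) (A := A) x
  have hev : outerNormal (quarticBody M A) =ᶠ[nhds x]
      fun y => ‖quarticGradient M A y‖⁻¹ • quarticGradient M A y := by
    filter_upwards [isOpen_ne.mem_nhds hx0] with y hy using outerNormal_quarticBody hM hy
  have hdiff : DifferentiableAt ℝ (fun y => ‖quarticGradient M A y‖⁻¹) x :=
    (hD.differentiableAt.norm ℝ hG).inv (norm_ne_zero_iff.2 hG)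
  have hpos : 0 < ‖quarticGradient M A x‖ := norm_pos_iff.2 hG
  have horth : inner ℝ (quarticGradient M A x) v = 0 := by
    rw [outerNormal_quarticBody hM hx0, real_inner_smul_left] at hnv
    exact (mul_eq_zero.1 hnv).resolve_left (inv_ne_zero hpos.ne')
  have hfd : HasFDerivAt (fun y => ‖quarticGradient M A y‖⁻¹ • quarticGradient M A y) _ x :=
    hdiff.hasFDerivAt.smul hD
  rw [secondFundamentalForm, hev.fderiv_eq, hfd.fderiv]
  simp only [add_apply, smul_apply,
    ContinuousLinearMap.smulRight_apply, inner_add_left, real_inner_smul_left, horth, hDv,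
    mul_zero, add_zero]
  have hxn := norm_pos_iff.2 hx0
  have hvn := norm_pos_iff.2 hv
  positivity

end QuarticBody

section GaussianSchwartz

theorem one_add_pow_mul_exp_neg_sq_le {κ : ℝ} (hκ : 0 < κ) (m : ℕ) {r : ℝ} (hr : 0 ≤ r) :
    (1 + r) ^ m * Real.exp (-κ * r ^ 2) ≤ m.factorial * Real.exp (1 + 1 / (4 * κ)) := by
  have h1 : (1 + r) ^ m ≤ m.factorial * Real.exp (1 + r) := by
    have := Real.pow_div_factorial_le_exp (1 + r) (by positivity) m
    rwa [div_le_iff₀' (by positivity)] at this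
  calc (1 + r) ^ m * Real.exp (-κ * r ^ 2)
      ≤ m.factorial * Real.exp (1 + r) * Real.exp (-κ * r ^ 2) := by gcongr
    _ = m.factorial * Real.exp (1 + r + -κ * r ^ 2) := by rw [mul_assoc, ← Real.exp_add]
    _ ≤ _ := by
      refine mul_le_mul_of_nonneg_left (Real.exp_le_exp.2 ?_) (by positivity)
      have : 1 / (4 * κ) - (r + -κ * r ^ 2) = κ * (r - 1 / (2 * κ)) ^ 2 := by
        field_simp
        ring
      have h2 : 0 ≤ κ * (r - 1 / (2 * κ)) ^ 2 := by positivity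
      linarith

variable {E : Type*} [NormedAddCommGroup E] [NormedSpace ℝ E]

/-- The exponential of a function of temperate growth that is bounded above by a negative multiple
of the squared norm, as a Schwartz function. -/
noncomputable def expSchwartz {f : E → ℝ} (hf : f.HasTemperateGrowth) {κ : ℝ} (hκ : 0 < κ)
    (hfκ : ∀ x, f x ≤ -κ * ‖x‖ ^ 2) : 𝓢(E, ℝ) where
  toFun x := Real.exp (f x)
  smooth' := Real.contDiff_exp.comp hf.1
  decay' k n := by
    obtain ⟨k₀, C₀, hC₀, hbd⟩ := hf.norm_iteratedFDeriv_le_uniform n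
    refine ⟨n.factorial * (1 + C₀) ^ n *
      ((k + k₀ * n).factorial * Real.exp (1 + 1 / (4 * κ))), fun x => ?_⟩
    have h1 : (1 : ℝ) ≤ (1 + ‖x‖) ^ k₀ := one_le_pow₀ (by linarith [norm_nonneg x])
    have hD : 1 ≤ (1 + C₀) * (1 + ‖x‖) ^ k₀ := one_le_mul_of_one_le_of_one_le (by linarith) h1
    have hbound := norm_iteratedFDeriv_comp_le (n := n) (N := ∞) Real.contDiff_exp hf.1
      (mod_cast le_top) x (C := Real.exp (f x)) (D := (1 + C₀) * (1 + ‖x‖) ^ k₀)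
      (fun i _ => by
        rw [norm_iteratedFDeriv_eq_norm_iteratedDeriv, iteratedDeriv_eq_iterate,
          Real.iter_deriv_exp, Real.norm_of_nonneg (Real.exp_pos _).le])
      (fun i hi hin => (hbd i hin x).trans (le_trans (by gcongr; linarith)
        (le_self_pow₀ hD (by omega))))
    calc ‖x‖ ^ k * ‖iteratedFDeriv ℝ n (fun x => Real.exp (f x)) x‖
        ≤ (1 + ‖x‖) ^ k * (n.factorial * Real.exp (-κ * ‖x‖ ^ 2) *
            ((1 + C₀) * (1 + ‖x‖) ^ k₀) ^ n) := by
          gcongr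
          · linarith
          · refine hbound.trans ?_
            gcongr
            exact hfκ x
      _ = n.factorial * (1 + C₀) ^ n *
            ((1 + ‖x‖) ^ (k + k₀ * n) * Real.exp (-κ * ‖x‖ ^ 2)) := by
          rw [mul_pow, pow_add, pow_mul]; ring
      _ ≤ _ := by
          exact mul_le_mul_of_nonneg_left (one_add_pow_mul_exp_neg_sq_le hκ _ (norm_nonneg x))
            (by positivity)

end GaussianSchwartz

section DiagonalGaussian

variable {ι : Type*} [Fintype ι]

theorem hasTemperateGrowth_neg_sum_mul_sq (c : ι → ℝ) :
    (fun x : EuclideanSpace ℝ ι => -∑ i, c i * x i ^ 2).HasTemperateGrowth := by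
  have (i : ι) : (fun x : EuclideanSpace ℝ ι => x i).HasTemperateGrowth :=
    (EuclideanSpace.proj i : EuclideanSpace ℝ ι →L[ℝ] ℝ).hasTemperateGrowth
  simp only [pow_two]
  fun_prop

theorem exists_neg_sum_mul_sq_le {c : ι → ℝ} (hc : ∀ i, 0 < c i) :
    ∃ κ : ℝ, 0 < κ ∧ ∀ x : EuclideanSpace ℝ ι, -∑ i, c i * x i ^ 2 ≤ -κ * ‖x‖ ^ 2 := by
  obtain ⟨κ, hκ, h⟩ : ∃ κ : ℝ, 0 < κ ∧ ∀ i, κ ≤ c i := by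
    rcases isEmpty_or_nonempty ι with hι | hι
    · exact ⟨1, one_pos, fun i => (hι.false i).elim⟩
    · obtain ⟨j, hj⟩ := Finite.exists_min c
      exact ⟨c j, hc j, hj⟩
  refine ⟨κ, hκ, fun x => ?_⟩
  rw [neg_mul, neg_le_neg_iff, EuclideanSpace.norm_sq_eq, Finset.mul_sum]
  refine Finset.sum_le_sum fun i _ => ?_
  rw [Real.norm_eq_abs, sq_abs]
  exact mul_le_mul_of_nonneg_right (h i) (sq_nonneg _)

/-- The Gaussian `exp (-∑ cᵢ xᵢ²)` as a Schwartz function. -/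
noncomputable def diagGaussian (c : ι → ℝ) (hc : ∀ i, 0 < c i) : 𝓢(EuclideanSpace ℝ ι, ℂ) :=
  SchwartzMap.postcompCLM (𝕜 := ℝ) Complex.ofRealCLM
    (expSchwartz (hasTemperateGrowth_neg_sum_mul_sq c) (exists_neg_sum_mul_sq_le hc).choose_spec.1
      (exists_neg_sum_mul_sq_le hc).choose_spec.2)

theorem diagGaussian_apply {c : ι → ℝ} (hc : ∀ i, 0 < c i) (x : EuclideanSpace ℝ ι) :
    diagGaussian c hc x = (Real.exp (-∑ i, c i * x i ^ 2) : ℂ) := rfl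

theorem conjReflect_diagGaussian {c : ι → ℝ} (hc : ∀ i, 0 < c i) :
    conjReflect (diagGaussian c hc) = diagGaussian c hc := by
  ext x
  rw [conjReflect_apply, diagGaussian_apply, diagGaussian_apply, Complex.conj_ofReal]
  simp

theorem convolution_diagGaussian_apply {b c : ι → ℝ} (hb : ∀ i, 0 < b i) (hc : ∀ i, 0 < c i)
    (x : EuclideanSpace ℝ ι) :
    SchwartzMap.convolution (ContinuousLinearMap.mul ℂ ℂ) (diagGaussian b hb) (diagGaussian c hc) x
      = ((∏ i, √(Real.pi / (b i + c i)) : ℝ) : ℂ) *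
        (Real.exp (-∑ i, b i * c i / (b i + c i) * x i ^ 2) : ℂ) := by
  rw [SchwartzMap.convolution_apply, MeasureTheory.convolution_def]
  simp only [ContinuousLinearMap.mul_apply', diagGaussian_apply, PiLp.sub_apply]
  rw [← (PiLp.volume_preserving_toLp ι).integral_comp
    (MeasurableEquiv.toLp 2 _).measurableEmbedding]
  have key (v : ι → ℝ) : (Real.exp (-∑ i, b i * v i ^ 2) : ℂ) *
      (Real.exp (-∑ i, c i * (x i - v i) ^ 2) : ℂ) =
      (Real.exp (-∑ i, c i * x i ^ 2) : ℂ) *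
      Complex.exp (-∑ i, ((b i + c i : ℝ) : ℂ) * (v i : ℂ) ^ 2 +
        ∑ i, ((2 * c i * x i : ℝ) : ℂ) * v i) := by
    push_cast
    rw [← Complex.exp_add, ← Complex.exp_add]
    congr 1
    simp only [← Finset.sum_neg_distrib, ← Finset.sum_add_distrib]
    refine Finset.sum_congr rfl fun i _ => ?_
    ring
  simp only [key]
  rw [MeasureTheory.integral_const_mul, GaussianFourier.integral_cexp_neg_sum_mul_add
    (fun i => by simpa using add_pos (hb i) (hc i)), Finset.prod_mul_distrib,
    ← Complex.exp_sum, mul_left_comm]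
  congr 1
  · push_cast
    refine Finset.prod_congr rfl fun i _ => ?_
    have h := add_pos (hb i) (hc i)
    rw [Real.sqrt_eq_rpow, Complex.ofReal_cpow (by positivity)]
    push_cast
    rfl
  · push_cast
    rw [← Complex.exp_add]
    congr 1
    simp only [← Finset.sum_neg_distrib, ← Finset.sum_add_distrib]
    refine Finset.sum_congr rfl fun i _ => ?_
    have h : (b i : ℂ) + c i ≠ 0 := by exact_mod_cast (add_pos (hb i) (hc i)).ne'
    field_simp
    ring

end DiagonalGaussian

open MeasureTheory

section RadialIntegrability

variable {E : Type*} [NormedAddCommGroup E] [NormedSpace ℝ E] [FiniteDimensional ℝ E]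
  [Nontrivial E] [MeasurableSpace E] [BorelSpace E] (μ : Measure E) [μ.IsAddHaarMeasure]

theorem integrable_norm_rpow_mul_one_add_norm_rpow {β γ : ℝ} (hβ : β < Module.finrank ℝ E)
    (hγ : Module.finrank ℝ E < β + γ) :
    Integrable (fun x : E => ‖x‖ ^ (-β) * (1 + ‖x‖) ^ (-γ)) μ := by
  have hγ0 : 0 < γ := by linarith
  rw [integrable_fun_norm_addHaar μ (f := fun r => r ^ (-β) * (1 + r) ^ (-γ))]
  have hd : 0 < Module.finrank ℝ E := Module.finrank_pos
  set d := Module.finrank ℝ E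
  have hpow {y : ℝ} (hy : 0 < y) : y ^ (d - 1) • (y ^ (-β) * (1 + y) ^ (-γ)) =
      y ^ ((d : ℝ) - 1 - β) * (1 + y) ^ (-γ) := by
    rw [smul_eq_mul, ← mul_assoc, ← Real.rpow_natCast, ← Real.rpow_add hy, Nat.cast_pred hd]
    ring_nf
  have hmeas : Measurable fun y : ℝ => y ^ (d - 1) • (y ^ (-β) * (1 + y) ^ (-γ)) := by
    simp only [smul_eq_mul]; fun_prop
  rw [← Set.Ioc_union_Ioi_eq_Ioi zero_le_one]
  refine IntegrableOn.union ?_ ?_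
  · have h : IntegrableOn (fun y : ℝ => y ^ ((d : ℝ) - 1 - β)) (Set.Ioc 0 1) := by
      rw [← intervalIntegrable_iff_integrableOn_Ioc_of_le zero_le_one]
      exact intervalIntegral.intervalIntegrable_rpow' (by linarith)
    refine Integrable.mono' h hmeas.aestronglyMeasurable ?_
    filter_upwards [ae_restrict_mem measurableSet_Ioc] with y hy
    have hy0 : 0 < y := hy.1
    rw [hpow hy0, Real.norm_of_nonneg (by positivity)]
    refine mul_le_of_le_one_right (by positivity) ?_
    exact Real.rpow_le_one_of_one_le_of_nonpos (by linarith) (by linarith)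
  · have h : IntegrableOn (fun y : ℝ => y ^ ((d : ℝ) - 1 - β + -γ)) (Set.Ioi 1) :=
      integrableOn_Ioi_rpow_of_lt (by linarith) one_pos
    refine Integrable.mono' h hmeas.aestronglyMeasurable ?_
    filter_upwards [ae_restrict_mem measurableSet_Ioi] with y hy
    have hy0 : 0 < y := lt_trans one_pos hy
    rw [hpow hy0, Real.norm_of_nonneg (by positivity), Real.rpow_add hy0]
    gcongr ?_ * ?_
    exact Real.rpow_le_rpow_of_nonpos hy0 (by linarith) (by linarith)

end RadialIntegrability

section FunctionDistribution

variable {E : Type*} [NormedAddCommGroup E] [InnerProductSpace ℝ E] [FiniteDimensional ℝ E]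
  [Nontrivial E] [MeasurableSpace E] [BorelSpace E]

/-- A nonnegative function bounded by an integrable power of the norm is a tempered
distribution. -/
theorem exists_isGivenBy {f : E → ℝ} (hf : Measurable f) (hf0 : ∀ x, 0 ≤ f x) {β : ℝ}
    (hβ : β < Module.finrank ℝ E) (hfβ : ∀ x, f x ≤ ‖x‖ ^ (-β)) :
    ∃ T : 𝓢'(E, ℂ), IsGivenBy T f := by
  let w : E → NNReal := fun x => (f x).toNNReal
  have hw : Measurable w := hf.real_toNNReal
  have hwf (x : E) : ((w x : NNReal) : ℝ) = f x := Real.coe_toNNReal _ (hf0 x)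
  let μ : Measure E := volume.withDensity fun x => (w x : ENNReal)
  have hμ : μ.HasTemperateGrowth := by
    obtain ⟨N, hN⟩ := exists_nat_gt ((Module.finrank ℝ E : ℝ) - β)
    refine ⟨N, (integrable_withDensity_iff_integrable_smul hw).2 ?_⟩
    refine (integrable_norm_rpow_mul_one_add_norm_rpow volume hβ (γ := N) (by linarith)).mono'
      (by fun_prop) (Filter.Eventually.of_forall fun x => ?_)
    rw [NNReal.smul_def, hwf, smul_eq_mul,
      Real.norm_of_nonneg (mul_nonneg (hf0 x) (by positivity))]
    gcongr
    exact hfβ x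
  refine ⟨μ.toTemperedDistribution, fun φ => ⟨?_, ?_⟩⟩
  · have := (integrable_withDensity_iff_integrable_smul hw).1 (φ.integrable (μ := μ))
    simpa [NNReal.smul_def, hwf] using this
  · rw [Measure.toTemperedDistribution_apply μ, integral_withDensity_eq_integral_smul hw]
    simp [NNReal.smul_def, hwf]

end FunctionDistribution

section RadialProfiles

/-- A second difference of the heat kernels `exp (-s² / t) / t` of the plane at `t = 1, 2, 3`. -/
noncomputable def heatDifference (s : ℝ) : ℝ :=
  Real.exp (-1 * s ^ 2) - Real.exp (-(1 / 2) * s ^ 2) + 1 / 3 * Real.exp (-(1 / 3) * s ^ 2)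

theorem continuous_heatDifference : Continuous heatDifference := by
  unfold heatDifference; fun_prop

theorem abs_heatDifference_le (s : ℝ) :
    |heatDifference s| ≤ 3 * Real.exp (-(1 / 3) * s ^ 2) := by
  have hs := sq_nonneg s
  have h1 : Real.exp (-1 * s ^ 2) ≤ Real.exp (-(1 / 3) * s ^ 2) :=
    Real.exp_le_exp.2 (by linarith)
  have h2 : Real.exp (-(1 / 2) * s ^ 2) ≤ Real.exp (-(1 / 3) * s ^ 2) :=
    Real.exp_le_exp.2 (by linarith)
  have h3 := Real.exp_pos (-1 * s ^ 2)
  have h4 := Real.exp_pos (-(1 / 2) * s ^ 2)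
  rw [abs_le, heatDifference]
  constructor <;> linarith

/-- The difference of `r ^ (-α - 2)` and `r ^ (-α) (r⁴ + s⁴) ^ (-1/2)`. -/
noncomputable def quarticDeficit (α r s : ℝ) : ℝ :=
  r ^ (-α) * ((r ^ 2)⁻¹ - (√(r ^ 4 + s ^ 4))⁻¹)

theorem sq_le_sqrt_add_pow_four (r s : ℝ) : r ^ 2 ≤ √(r ^ 4 + s ^ 4) := by
  apply Real.le_sqrt_of_sq_le
  have : 0 ≤ s ^ 4 := by positivity
  nlinarith

theorem quarticDeficit_nonneg (α : ℝ) {r : ℝ} (hr : 0 < r) (s : ℝ) :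
    0 ≤ quarticDeficit α r s := by
  refine mul_nonneg (by positivity) (sub_nonneg.2 ?_)
  exact inv_anti₀ (by positivity) (sq_le_sqrt_add_pow_four r s)

theorem quarticDeficit_pos (α : ℝ) {r s : ℝ} (hr : 0 < r) (hs : 0 < s) :
    0 < quarticDeficit α r s := by
  refine mul_pos (by positivity) (sub_pos.2 (inv_strictAnti₀ (by positivity) ?_))
  apply Real.lt_sqrt_of_sq_lt
  have : 0 < s ^ 4 := by positivity
  nlinarith

theorem quarticDeficit_smul (α r s : ℝ) {c : ℝ} (hc : 0 < c) (hr : 0 ≤ r) :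
    quarticDeficit α (c * r) (c * s) = c ^ (-(α + 2)) * quarticDeficit α r s := by
  have h1 : √((c * r) ^ 4 + (c * s) ^ 4) = c ^ 2 * √(r ^ 4 + s ^ 4) := by
    have : (c * r) ^ 4 + (c * s) ^ 4 = (c ^ 2) ^ 2 * (r ^ 4 + s ^ 4) := by ring
    rw [this, Real.sqrt_mul (by positivity), Real.sqrt_sq (by positivity)]
  have h2 : c ^ (-(α + 2)) = c ^ (-α) * (c ^ 2)⁻¹ := by
    rw [neg_add, Real.rpow_add hc, Real.rpow_neg hc.le 2, Real.rpow_two]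
  rw [quarticDeficit, h1, h2, Real.mul_rpow hc.le hr, mul_pow, quarticDeficit, mul_inv, mul_inv]
  ring

theorem quarticDeficit_le (α : ℝ) {r s : ℝ} (hr : 0 < r) (hs : 0 ≤ s) :
    quarticDeficit α r s ≤ 16 * (r ^ (-(α + 2)) * (1 + r) ^ (-4 : ℝ)) * (1 + s) ^ 4 := by
  have h2 : r ^ (-(α + 2)) = r ^ (-α) * (r ^ 2)⁻¹ := by
    rw [neg_add, Real.rpow_add hr, Real.rpow_neg hr.le 2, Real.rpow_two]
  have h4 : (1 + r) ^ (-4 : ℝ) = ((1 + r) ^ 4)⁻¹ := by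
    rw [Real.rpow_neg (by positivity)]
    norm_cast
  have key : (r ^ 2)⁻¹ - (√(r ^ 4 + s ^ 4))⁻¹ ≤
      (r ^ 2)⁻¹ * (16 * ((1 + r) ^ 4)⁻¹ * (1 + s) ^ 4) := by
    rcases le_total r 1 with h | h
    · have h5 : (1 : ℝ) ≤ 16 * ((1 + r) ^ 4)⁻¹ * (1 + s) ^ 4 := by
        have h6 : (1 + r) ^ 4 ≤ 2 ^ 4 := by gcongr; linarith
        have h7 : (1 : ℝ) ≤ (1 + s) ^ 4 := one_le_pow₀ (by linarith)
        have h8 : 1 ≤ 16 * ((1 + r) ^ 4)⁻¹ := by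
          rw [← div_eq_mul_inv, one_le_div (by positivity)]
          linarith
        exact one_le_mul_of_one_le_of_one_le h8 h7
      have h9 : 0 ≤ (√(r ^ 4 + s ^ 4))⁻¹ := by positivity
      have h10 : 0 ≤ (r ^ 2)⁻¹ := by positivity
      nlinarith
    · have hD := sq_le_sqrt_add_pow_four r s
      have hD2 : √(r ^ 4 + s ^ 4) ^ 2 = r ^ 4 + s ^ 4 := Real.sq_sqrt (by positivity)
      set D := √(r ^ 4 + s ^ 4)
      have hm : 0 < r ^ 2 := by positivity
      have hDpos : 0 < D := hm.trans_le hD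
      have h5 : (r ^ 2)⁻¹ - D⁻¹ ≤ (r ^ 2)⁻¹ * (s ^ 4 / r ^ 4) := by
        have : (r ^ 2)⁻¹ * (s ^ 4 / r ^ 4) - ((r ^ 2)⁻¹ - D⁻¹) =
            ((D - r ^ 2) * (D * (D + r ^ 2) - r ^ 4)) / (r ^ 6 * D) := by
          field_simp
          linear_combination -D * hD2
        have h6 : 0 ≤ D * (D + r ^ 2) - r ^ 4 := by nlinarith
        have h7 : 0 ≤ ((D - r ^ 2) * (D * (D + r ^ 2) - r ^ 4)) / (r ^ 6 * D) :=
          div_nonneg (mul_nonneg (sub_nonneg.2 hD) h6) (by positivity)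
        linarith
      refine h5.trans (mul_le_mul_of_nonneg_left ?_ (by positivity))
      rw [← div_eq_mul_inv, div_mul_eq_mul_div, div_le_div_iff₀ (by positivity) (by positivity)]
      have h6 : (1 + r) ^ 4 ≤ (2 * r) ^ 4 := by gcongr; linarith
      have h7 : s ^ 4 ≤ (1 + s) ^ 4 := by gcongr; linarith
      calc s ^ 4 * (1 + r) ^ 4 ≤ (1 + s) ^ 4 * (2 * r) ^ 4 := by gcongr
        _ = _ := by ring
  calc quarticDeficit α r s
      ≤ r ^ (-α) * ((r ^ 2)⁻¹ * (16 * ((1 + r) ^ 4)⁻¹ * (1 + s) ^ 4)) :=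
        mul_le_mul_of_nonneg_left key (by positivity)
    _ = _ := by rw [h2, h4]; ring

theorem exists_pow_mul_exp_le_rpow (k : ℕ) (γ : ℝ) {a : ℝ} (ha : 0 < a) : ∃ K : ℝ, 0 ≤ K ∧
    ∀ r : ℝ, 0 ≤ r → (1 + r) ^ k * Real.exp (-a * r ^ 2) ≤ K * (1 + r) ^ (-γ) := by
  obtain ⟨N, hN⟩ := exists_nat_ge γ
  refine ⟨(k + N).factorial * Real.exp (1 + 1 / (4 * a)), by positivity, fun r hr => ?_⟩
  have h := one_add_pow_mul_exp_neg_sq_le ha (k + N) hr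
  have h1 : (1 + r) ^ k = (1 + r) ^ (k + N) * (1 + r) ^ (-(N : ℝ)) := by
    rw [Real.rpow_neg (by positivity), Real.rpow_natCast, pow_add]
    field_simp
  calc (1 + r) ^ k * Real.exp (-a * r ^ 2)
      = (1 + r) ^ (k + N) * Real.exp (-a * r ^ 2) * (1 + r) ^ (-(N : ℝ)) := by rw [h1]; ring
    _ ≤ _ := by
      gcongr
      linarith

end RadialProfiles

section ProductSpace

set_option linter.unusedSectionVars false

variable {X Z : Type*} [NormedAddCommGroup X] [InnerProductSpace ℝ X] [FiniteDimensional ℝ X]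
  [Nontrivial X] [MeasurableSpace X] [BorelSpace X]
  [NormedAddCommGroup Z] [InnerProductSpace ℝ Z] [FiniteDimensional ℝ Z]
  [MeasurableSpace Z] [BorelSpace Z]

theorem ae_fst_ne_zero : ∀ᵐ x : X × Z, x.1 ≠ 0 :=
  Measure.quasiMeasurePreserving_fst.ae (Measure.ae_ne volume 0)

instance : (volume : Measure (X × Z)).IsAddHaarMeasure :=
  Measure.prod.instIsAddHaarMeasure volume volume

theorem integral_mul_heatDifference {Ω : Type*} [MeasurableSpace Ω] {μ : Measure Ω} {w n : Ω → ℝ}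
    (h : ∀ c : ℝ, 0 < c → Integrable (fun x => w x * Real.exp (-c * n x ^ 2)) μ) :
    ∫ x, w x * heatDifference (n x) ∂μ = (∫ x, w x * Real.exp (-1 * n x ^ 2) ∂μ) -
      (∫ x, w x * Real.exp (-(1 / 2) * n x ^ 2) ∂μ) +
      1 / 3 * ∫ x, w x * Real.exp (-(1 / 3) * n x ^ 2) ∂μ := by
  rw [← integral_sub (h _ one_pos) (h _ (by norm_num)), ← integral_const_mul,
    ← integral_add ((h _ one_pos).sub' (h _ (by norm_num))) ((h _ (by norm_num)).const_mul _)]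
  refine integral_congr_ae (Filter.Eventually.of_forall fun x => ?_)
  simp only [heatDifference]
  ring

theorem integral_heatDifference (hZ : Module.finrank ℝ Z = 2) :
    ∫ z : Z, heatDifference ‖z‖ = 0 := by
  have hI (b : ℝ) (hb : 0 < b) : Integrable fun z : Z => (1 : ℝ) * Real.exp (-b * ‖z‖ ^ 2) := by
    have := (GaussianFourier.integrable_cexp_neg_mul_sq_norm_add (V := Z) (b := b)
      (by simpa using hb) 0 0).re
    refine this.congr (Filter.Eventually.of_forall fun z => ?_)
    simp only [zero_mul, add_zero, one_mul]
    rw [← Complex.exp_ofReal_re]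
    norm_cast
  have hE {b : ℝ} (hb : 0 < b) : ∫ z : Z, Real.exp (-b * ‖z‖ ^ 2) = Real.pi / b := by
    rw [GaussianFourier.integral_rexp_neg_mul_sq_norm hb, hZ]
    norm_num
  have h := integral_mul_heatDifference hI
  simp only [one_mul] at h
  rw [h, hE (by norm_num), hE (by norm_num), hE (by norm_num)]
  ring

variable [Nontrivial Z] {α : ℝ}

theorem measurable_quarticDeficit_norm :
    Measurable fun x : X × Z => quarticDeficit α ‖x.1‖ ‖x.2‖ := by
  unfold quarticDeficit; fun_prop

theorem integrable_one_add_norm_rpow_prod {β γ δ : ℝ} (hβ : β < Module.finrank ℝ X)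
    (hγ : Module.finrank ℝ X < β + γ) (hδ : Module.finrank ℝ Z < δ) :
    Integrable fun x : X × Z => ‖x.1‖ ^ (-β) * (1 + ‖x.1‖) ^ (-γ) * (1 + ‖x.2‖) ^ (-δ) := by
  refine (integrable_norm_rpow_mul_one_add_norm_rpow (volume : Measure X) hβ hγ).mul_prod
    (g := fun z : Z => (1 + ‖z‖) ^ (-δ)) ?_
  exact integrable_one_add_norm hδ

theorem integrable_quarticDeficit_mul_exp (h1 : α + 2 < Module.finrank ℝ X)
    (h2 : Module.finrank ℝ X < α + 6) {c : ℝ} (hc : 0 < c) :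
    Integrable fun x : X × Z => quarticDeficit α ‖x.1‖ ‖x.2‖ * Real.exp (-c * ‖x.2‖ ^ 2) := by
  obtain ⟨K, hK, hKs⟩ := exists_pow_mul_exp_le_rpow 4 (Module.finrank ℝ Z + 1) hc
  refine ((integrable_one_add_norm_rpow_prod (X := X) (Z := Z) (β := α + 2) (γ := 4)
    (δ := Module.finrank ℝ Z + 1) h1 (by linarith) (by linarith)).const_mul (16 * K)).mono'
    (measurable_quarticDeficit_norm.mul (by fun_prop)).aestronglyMeasurable ?_
  filter_upwards [ae_fst_ne_zero] with x hx
  have hr := norm_pos_iff.2 hx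
  rw [Real.norm_of_nonneg (mul_nonneg (quarticDeficit_nonneg α hr _) (Real.exp_pos _).le)]
  calc _ ≤ 16 * (‖x.1‖ ^ (-(α + 2)) * (1 + ‖x.1‖) ^ (-4 : ℝ)) * (1 + ‖x.2‖) ^ 4 *
        Real.exp (-c * ‖x.2‖ ^ 2) := by
        gcongr
        exact quarticDeficit_le α hr (norm_nonneg _)
    _ = 16 * (‖x.1‖ ^ (-(α + 2)) * (1 + ‖x.1‖) ^ (-4 : ℝ)) *
        ((1 + ‖x.2‖) ^ 4 * Real.exp (-c * ‖x.2‖ ^ 2)) := by ring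
    _ ≤ 16 * (‖x.1‖ ^ (-(α + 2)) * (1 + ‖x.1‖) ^ (-4 : ℝ)) *
        (K * (1 + ‖x.2‖) ^ (-(Module.finrank ℝ Z + 1 : ℝ))) := by
        refine mul_le_mul_of_nonneg_left (hKs _ (norm_nonneg x.2)) (by positivity)
    _ = _ := by ring

theorem integral_quarticDeficit_mul_exp {c : ℝ} (hc : 0 < c) :
    ∫ x : X × Z, quarticDeficit α ‖x.1‖ ‖x.2‖ * Real.exp (-c * ‖x.2‖ ^ 2) =
      c ^ (-((Module.finrank ℝ X + Module.finrank ℝ Z - 2 - α) / 2)) *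
        ∫ x : X × Z, quarticDeficit α ‖x.1‖ ‖x.2‖ * Real.exp (-1 * ‖x.2‖ ^ 2) := by
  have hl : 0 < (√c)⁻¹ := by positivity
  have hls : ((√c)⁻¹) ^ 2 = c⁻¹ := by rw [inv_pow, Real.sq_sqrt hc.le]
  have hlc : (√c)⁻¹ = c ^ (-(1 / 2) : ℝ) := by rw [Real.sqrt_eq_rpow, Real.rpow_neg hc.le]
  have h := Measure.integral_comp_smul_of_nonneg (volume : Measure (X × Z))
    (fun x : X × Z => quarticDeficit α ‖x.1‖ ‖x.2‖ * Real.exp (-c * ‖x.2‖ ^ 2)) (√c)⁻¹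
    (hR := hl.le)
  have h' (x : X × Z) : quarticDeficit α ‖((√c)⁻¹ • x).1‖ ‖((√c)⁻¹ • x).2‖ *
      Real.exp (-c * ‖((√c)⁻¹ • x).2‖ ^ 2) = ((√c)⁻¹) ^ (-(α + 2)) *
      (quarticDeficit α ‖x.1‖ ‖x.2‖ * Real.exp (-1 * ‖x.2‖ ^ 2)) := by
    rw [Prod.smul_fst, Prod.smul_snd, norm_smul, norm_smul, Real.norm_of_nonneg hl.le,
      quarticDeficit_smul α _ _ hl (norm_nonneg _), mul_pow, hls, mul_assoc]
    congr 3
    field_simp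
  simp only [h'] at h
  rw [integral_const_mul, smul_eq_mul, eq_inv_mul_iff_mul_eq₀ (by positivity)] at h
  rw [← h, ← mul_assoc]
  congr 1
  rw [Module.finrank_prod, hlc, ← Real.rpow_natCast, ← Real.rpow_mul hc.le, ← Real.rpow_mul hc.le,
    ← Real.rpow_add hc]
  congr 1
  push_cast
  ring

theorem integral_quarticDeficit_mul_exp_pos (h1 : α + 2 < Module.finrank ℝ X)
    (h2 : Module.finrank ℝ X < α + 6) :
    0 < ∫ x : X × Z, quarticDeficit α ‖x.1‖ ‖x.2‖ * Real.exp (-1 * ‖x.2‖ ^ 2) := by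
  rw [integral_pos_iff_support_of_nonneg_ae]
  · have hopen : IsOpen {x : X × Z | x.1 ≠ 0 ∧ x.2 ≠ 0} :=
      (isOpen_ne.preimage continuous_fst).inter (isOpen_ne.preimage continuous_snd)
    obtain ⟨x₀, hx₀⟩ := exists_ne (0 : X)
    obtain ⟨z₀, hz₀⟩ := exists_ne (0 : Z)
    refine (hopen.measure_pos volume ⟨(x₀, z₀), hx₀, hz₀⟩).trans_le (measure_mono ?_)
    rintro x ⟨hx, hz⟩
    exact (mul_pos (quarticDeficit_pos α (norm_pos_iff.2 hx) (norm_pos_iff.2 hz))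
      (Real.exp_pos _)).ne'
  · filter_upwards [ae_fst_ne_zero] with x hx
    exact mul_nonneg (quarticDeficit_nonneg α (norm_pos_iff.2 hx) _) (Real.exp_pos _).le
  · exact integrable_quarticDeficit_mul_exp h1 h2 one_pos

theorem one_sub_two_rpow_add_three_rpow_pos {e : ℝ} (he : 2 < e) :
    0 < 1 - (1 / 2 : ℝ) ^ (-e) + 1 / 3 * (1 / 3 : ℝ) ^ (-e) := by
  have h := (strictConvexOn_rpow (p := e - 1) (by linarith)).2 (Set.mem_Ici.2 (zero_le_one' ℝ))
    (Set.mem_Ici.2 (zero_le_three (α := ℝ))) (by norm_num) one_half_pos one_half_pos (add_halves 1)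
  rw [one_div, one_div, Real.inv_rpow (by norm_num), Real.inv_rpow (by norm_num),
    Real.rpow_neg (by norm_num), Real.rpow_neg (by norm_num), inv_inv, inv_inv]
  norm_num at h
  rw [Real.rpow_sub_one (by norm_num), Real.rpow_sub_one (by norm_num)] at h
  linarith

theorem integral_quarticDeficit_mul_heatDifference_pos (hZ : Module.finrank ℝ Z = 2)
    (h1 : α + 4 < Module.finrank ℝ X) (h2 : Module.finrank ℝ X < α + 6) :
    0 < ∫ x : X × Z, quarticDeficit α ‖x.1‖ ‖x.2‖ * heatDifference ‖x.2‖ := by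
  have hI {c : ℝ} (hc : 0 < c) := integrable_quarticDeficit_mul_exp (X := X) (Z := Z) (α := α)
    (by linarith) h2 hc
  rw [integral_mul_heatDifference fun c hc => hI hc,
    integral_quarticDeficit_mul_exp (c := 1 / 2) (by norm_num),
    integral_quarticDeficit_mul_exp (c := 1 / 3) (by norm_num), hZ]
  have hJ := integral_quarticDeficit_mul_exp_pos (X := X) (Z := Z) (α := α) (by linarith) h2
  have he := one_sub_two_rpow_add_three_rpow_pos
    (e := (Module.finrank ℝ X + (2 : ℕ) - 2 - α) / 2) (by push_cast; linarith)
  have := mul_pos he hJ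
  linarith

end ProductSpace

section Limits

set_option linter.unusedSectionVars false

open Filter Topology

variable {X Z : Type*} [NormedAddCommGroup X] [InnerProductSpace ℝ X] [FiniteDimensional ℝ X]
  [Nontrivial X] [MeasurableSpace X] [BorelSpace X]
  [NormedAddCommGroup Z] [InnerProductSpace ℝ Z] [FiniteDimensional ℝ Z]
  [MeasurableSpace Z] [BorelSpace Z]

theorem integral_comp_smul_snd (F : X × Z → ℝ) {ε : ℝ} (hε : ε ≠ 0) :
    ∃ c : ℝ, 0 < c ∧ ∫ x : X × Z, F (x.1, ε • x.2) = c * ∫ x : X × Z, F x := by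
  let e : (X × Z) ≃ₗ[ℝ] (X × Z) :=
    LinearEquiv.prodCongr (LinearEquiv.refl ℝ X) (LinearEquiv.smulOfNeZero ℝ Z ε hε)
  have hdet : LinearMap.det (e : (X × Z) →ₗ[ℝ] (X × Z)) ≠ 0 := e.isUnit_det'.ne_zero
  refine ⟨|(LinearMap.det (e : (X × Z) →ₗ[ℝ] (X × Z)))⁻¹|, by positivity, ?_⟩
  have hmap := Measure.map_linearMap_addHaar_eq_smul_addHaar (volume : Measure (X × Z)) hdet
  have h := e.toContinuousLinearEquiv.toHomeomorph.measurableEmbedding.integral_map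
    (μ := volume) F
  have hcoe : ⇑(e.toContinuousLinearEquiv.toHomeomorph) = ⇑(e : (X × Z) →ₗ[ℝ] (X × Z)) := rfl
  rw [hcoe, hmap, integral_smul_measure, ENNReal.toReal_ofReal (abs_nonneg _), smul_eq_mul] at h
  exact h.symm

variable [Nontrivial Z] {α : ℝ}

/-- The profile of `|x|^{-α} ‖x‖_L^{-2}` for the quartic body, in the variables `r = |B x|` and
`s = |A x| / ε`. -/
noncomputable def scaledKernel (α ε r s : ℝ) : ℝ :=
  (r ^ 2 + ε ^ 2 * s ^ 2) ^ (-α / 2) * (√((r ^ 2 + ε ^ 2 * s ^ 2) ^ 2 + s ^ 4))⁻¹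

theorem scaledKernel_nonneg (α ε r s : ℝ) : 0 ≤ scaledKernel α ε r s := by
  unfold scaledKernel; positivity

theorem measurable_scaledKernel_norm (ε : ℝ) :
    Measurable fun x : X × Z => scaledKernel α ε ‖x.1‖ ‖x.2‖ := by
  unfold scaledKernel; fun_prop

theorem scaledKernel_zero (α : ℝ) {r : ℝ} (hr : 0 < r) (s : ℝ) :
    scaledKernel α 0 r s = r ^ (-(α + 2)) - quarticDeficit α r s := by
  have h1 : (r ^ 2 + 0 ^ 2 * s ^ 2) ^ (-α / 2) = r ^ (-α) := by
    rw [zero_pow two_ne_zero, zero_mul, add_zero, ← Real.rpow_natCast, ← Real.rpow_mul hr.le]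
    congr 1
    push_cast
    ring
  have h2 : r ^ (-(α + 2)) = r ^ (-α) * (r ^ 2)⁻¹ := by
    rw [neg_add, Real.rpow_add hr, Real.rpow_neg hr.le 2, Real.rpow_two]
  rw [scaledKernel, h1, h2, quarticDeficit, zero_pow two_ne_zero, zero_mul, add_zero, ← pow_mul]
  ring

theorem scaledKernel_le (hα : -2 ≤ α) {ε r s : ℝ} (hε : ε ∈ Set.Ioo (0 : ℝ) 1) (hr : 0 < r)
    (hs : 0 ≤ s) : scaledKernel α ε r s ≤
      r ^ (-(α + 2)) + r ^ (-2 : ℝ) * ((1 + r) ^ 2 * (1 + s) ^ 2) := by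
  have hq : ε ^ 2 * s ^ 2 ≤ s ^ 2 :=
    mul_le_of_le_one_left (by positivity) (pow_le_one₀ hε.1.le hε.2.le)
  have hq0 : 0 ≤ ε ^ 2 * s ^ 2 := by positivity
  have h1 : (√((r ^ 2 + ε ^ 2 * s ^ 2) ^ 2 + s ^ 4))⁻¹ ≤ r ^ (-2 : ℝ) := by
    rw [Real.rpow_neg hr.le, Real.rpow_two]
    refine inv_anti₀ (by positivity) (Real.le_sqrt_of_sq_le ?_)
    have : (r ^ 2) ^ 2 ≤ (r ^ 2 + ε ^ 2 * s ^ 2) ^ 2 := by gcongr; linarith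
    have : 0 ≤ s ^ 4 := by positivity
    linarith
  have h2 : (r ^ 2 + ε ^ 2 * s ^ 2) ^ (-α / 2) ≤ r ^ (-α) + (1 + r) ^ 2 * (1 + s) ^ 2 := by
    rcases le_total 0 α with h | h
    · have h3 : (r ^ 2 + ε ^ 2 * s ^ 2) ^ (-α / 2) ≤ (r ^ 2) ^ (-α / 2) :=
        Real.rpow_le_rpow_of_nonpos (by positivity) (by linarith) (by linarith)
      have h4 : (r ^ 2) ^ (-α / 2) = r ^ (-α) := by
        rw [← Real.rpow_natCast, ← Real.rpow_mul hr.le]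
        congr 1
        push_cast
        ring
      rw [h4] at h3
      have : 0 ≤ (1 + r) ^ 2 * (1 + s) ^ 2 := by positivity
      linarith
    · have h3 : (r ^ 2 + ε ^ 2 * s ^ 2) ^ (-α / 2) ≤ ((1 + r) ^ 2 * (1 + s) ^ 2) ^ (-α / 2) := by
        refine Real.rpow_le_rpow (by positivity) ?_ (by linarith)
        have : 0 ≤ r * s := by positivity
        nlinarith [mul_nonneg hr.le (sq_nonneg s), mul_nonneg hs (sq_nonneg r),
          sq_nonneg (r * s)]
      have h4 : ((1 + r) ^ 2 * (1 + s) ^ 2) ^ (-α / 2) ≤ ((1 + r) ^ 2 * (1 + s) ^ 2) ^ (1 : ℝ) := by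
        refine Real.rpow_le_rpow_of_exponent_le ?_ (by linarith)
        exact one_le_mul_of_one_le_of_one_le (one_le_pow₀ (by linarith))
          (one_le_pow₀ (by linarith))
      rw [Real.rpow_one] at h4
      have : 0 ≤ r ^ (-α) := by positivity
      linarith
  calc scaledKernel α ε r s
      ≤ (r ^ (-α) + (1 + r) ^ 2 * (1 + s) ^ 2) * r ^ (-2 : ℝ) :=
        mul_le_mul h2 h1 (by positivity) (by positivity)
    _ = _ := by rw [neg_add, Real.rpow_add hr]; ring

theorem tendsto_scaledKernel (α : ℝ) {r : ℝ} (hr : 0 < r) (s : ℝ) :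
    Tendsto (fun ε => scaledKernel α ε r s) (𝓝[>] 0) (𝓝 (scaledKernel α 0 r s)) := by
  refine Tendsto.mono_left ?_ nhdsWithin_le_nhds
  have : ContinuousAt (fun ε => scaledKernel α ε r s) 0 := by
    unfold scaledKernel
    refine ContinuousAt.mul (ContinuousAt.rpow_const (by fun_prop) (Or.inl ?_))
      (ContinuousAt.inv₀ (by fun_prop) ?_) <;> positivity
  exact this

theorem integrable_norm_rpow_mul_exp_mul_heatDifference {β : ℝ} (hβ : β < Module.finrank ℝ X)
    {a : ℝ} (ha : 0 < a) (k : ℕ) :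
    Integrable fun x : X × Z => ‖x.1‖ ^ (-β) * ((1 + ‖x.1‖) ^ k * (1 + ‖x.2‖) ^ k) *
      (Real.exp (-a * ‖x.1‖ ^ 2) * heatDifference ‖x.2‖) := by
  obtain ⟨K, hK, hKr⟩ := exists_pow_mul_exp_le_rpow k (Module.finrank ℝ X - β + 1) ha
  obtain ⟨K', hK', hKs⟩ := exists_pow_mul_exp_le_rpow k (Module.finrank ℝ Z + 1)
    (a := 1 / 3) (by norm_num)
  refine ((integrable_one_add_norm_rpow_prod (X := X) (Z := Z) (β := β)
    (γ := Module.finrank ℝ X - β + 1) (δ := Module.finrank ℝ Z + 1) hβ (by linarith)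
    (by linarith)).const_mul (3 * K * K')).mono' ?_ (Eventually.of_forall fun x => ?_)
  · have := continuous_heatDifference.measurable
    exact Measurable.aestronglyMeasurable (by fun_prop)
  · rw [norm_mul, norm_mul (Real.exp _), Real.norm_of_nonneg (by positivity),
      Real.norm_of_nonneg (Real.exp_pos _).le, Real.norm_eq_abs]
    calc _ ≤ ‖x.1‖ ^ (-β) * ((1 + ‖x.1‖) ^ k * (1 + ‖x.2‖) ^ k) *
          (Real.exp (-a * ‖x.1‖ ^ 2) * (3 * Real.exp (-(1 / 3) * ‖x.2‖ ^ 2))) := by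
          gcongr
          exact abs_heatDifference_le _
      _ = 3 * ‖x.1‖ ^ (-β) * ((1 + ‖x.1‖) ^ k * Real.exp (-a * ‖x.1‖ ^ 2)) *
          ((1 + ‖x.2‖) ^ k * Real.exp (-(1 / 3) * ‖x.2‖ ^ 2)) := by ring
      _ ≤ 3 * ‖x.1‖ ^ (-β) * (K * (1 + ‖x.1‖) ^ (-(Module.finrank ℝ X - β + 1))) *
          (K' * (1 + ‖x.2‖) ^ (-(Module.finrank ℝ Z + 1 : ℝ))) := by
          refine mul_le_mul (mul_le_mul_of_nonneg_left (hKr _ (norm_nonneg x.1)) (by positivity))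
            (hKs _ (norm_nonneg x.2)) (by positivity) (by positivity)
      _ = _ := by ring

theorem integrable_quarticDeficit_mul_heatDifference (h1 : α + 2 < Module.finrank ℝ X)
    (h2 : Module.finrank ℝ X < α + 6) {a : ℝ} (ha : 0 ≤ a) :
    Integrable fun x : X × Z => quarticDeficit α ‖x.1‖ ‖x.2‖ *
      (Real.exp (-a * ‖x.1‖ ^ 2) * heatDifference ‖x.2‖) := by
  refine ((integrable_quarticDeficit_mul_exp (X := X) (Z := Z) h1 h2 (c := 1 / 3)
    (by norm_num)).const_mul 3).mono' ?_ ?_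
  · have := continuous_heatDifference.measurable
    exact (measurable_quarticDeficit_norm.mul (by fun_prop)).aestronglyMeasurable
  · filter_upwards [ae_fst_ne_zero] with x hx
    have hW := quarticDeficit_nonneg α (norm_pos_iff.2 hx) ‖x.2‖
    rw [norm_mul, norm_mul, Real.norm_of_nonneg hW, Real.norm_of_nonneg (Real.exp_pos _).le,
      Real.norm_eq_abs, mul_left_comm (3 : ℝ)]
    refine mul_le_mul_of_nonneg_left ?_ hW
    refine (mul_le_of_le_one_left (abs_nonneg _) (Real.exp_le_one_iff.2 ?_)).trans
      (abs_heatDifference_le _)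
    have : 0 ≤ a * ‖x.1‖ ^ 2 := by positivity
    linarith

theorem exists_integral_scaledKernel_zero_neg (hZ : Module.finrank ℝ Z = 2)
    (h1 : α + 4 < Module.finrank ℝ X) (h2 : Module.finrank ℝ X < α + 6) :
    ∃ a : ℝ, 0 < a ∧ ∫ x : X × Z, scaledKernel α 0 ‖x.1‖ ‖x.2‖ *
      (Real.exp (-a * ‖x.1‖ ^ 2) * heatDifference ‖x.2‖) < 0 := by
  have hI {a : ℝ} (ha : 0 ≤ a) := integrable_quarticDeficit_mul_heatDifference (X := X) (Z := Z)
    (by linarith) h2 ha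
  have hlim : Tendsto (fun a : ℝ => ∫ x : X × Z, quarticDeficit α ‖x.1‖ ‖x.2‖ *
      (Real.exp (-a * ‖x.1‖ ^ 2) * heatDifference ‖x.2‖)) (𝓝[>] 0)
      (𝓝 (∫ x : X × Z, quarticDeficit α ‖x.1‖ ‖x.2‖ * heatDifference ‖x.2‖)) := by
    refine tendsto_integral_filter_of_dominated_convergence
      (fun x => ‖quarticDeficit α ‖x.1‖ ‖x.2‖ * (Real.exp (-0 * ‖x.1‖ ^ 2) *
        heatDifference ‖x.2‖)‖) ?_ ?_ (hI le_rfl).norm ?_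
    · filter_upwards [self_mem_nhdsWithin] with a ha
      exact (hI (le_of_lt ha)).aestronglyMeasurable
    · filter_upwards [self_mem_nhdsWithin] with a ha
      refine Eventually.of_forall fun x => ?_
      rw [norm_mul, norm_mul, norm_mul _ (_ * _), norm_mul (Real.exp _)]
      gcongr ?_ * (?_ * ?_)
      rw [Real.norm_of_nonneg (Real.exp_pos _).le, Real.norm_of_nonneg (Real.exp_pos _).le,
        Real.exp_le_exp]
      have : 0 ≤ a * ‖x.1‖ ^ 2 := mul_nonneg (le_of_lt ha) (by positivity)
      linarith
    · refine Eventually.of_forall fun x => Tendsto.mono_left ?_ nhdsWithin_le_nhds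
      have : Continuous fun a : ℝ => quarticDeficit α ‖x.1‖ ‖x.2‖ *
        (Real.exp (-a * ‖x.1‖ ^ 2) * heatDifference ‖x.2‖) := by fun_prop
      simpa using this.tendsto 0
  have hpos := integral_quarticDeficit_mul_heatDifference_pos (X := X) (Z := Z) hZ h1 h2
  obtain ⟨a, ha, ha0⟩ := ((hlim.eventually (lt_mem_nhds hpos)).and self_mem_nhdsWithin).exists
  refine ⟨a, ha0, ?_⟩
  have ha0' : 0 < a := ha0
  have hB := integrable_norm_rpow_mul_exp_mul_heatDifference (X := X) (Z := Z) (β := α + 2)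
    (by linarith) ha0' 0
  simp only [pow_zero, mul_one] at hB
  have hzero : ∫ x : X × Z, ‖x.1‖ ^ (-(α + 2)) *
      (Real.exp (-a * ‖x.1‖ ^ 2) * heatDifference ‖x.2‖) = 0 := by
    have := integral_prod_mul (μ := (volume : Measure X)) (ν := (volume : Measure Z))
      (fun x => ‖x‖ ^ (-(α + 2)) * Real.exp (-a * ‖x‖ ^ 2)) (fun z => heatDifference ‖z‖)
    rw [integral_heatDifference hZ, mul_zero] at this
    rw [Measure.volume_eq_prod]
    simpa only [mul_assoc] using this
  have heq : ∫ x : X × Z, scaledKernel α 0 ‖x.1‖ ‖x.2‖ *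
      (Real.exp (-a * ‖x.1‖ ^ 2) * heatDifference ‖x.2‖) =
      (∫ x : X × Z, ‖x.1‖ ^ (-(α + 2)) *
        (Real.exp (-a * ‖x.1‖ ^ 2) * heatDifference ‖x.2‖)) -
      ∫ x : X × Z, quarticDeficit α ‖x.1‖ ‖x.2‖ *
        (Real.exp (-a * ‖x.1‖ ^ 2) * heatDifference ‖x.2‖) := by
    rw [← integral_sub hB (hI ha0'.le)]
    refine integral_congr_ae ?_
    filter_upwards [ae_fst_ne_zero] with x hx
    rw [scaledKernel_zero α (norm_pos_iff.2 hx), sub_mul]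
  rw [heq, hzero, zero_sub]
  linarith

theorem exists_integral_scaledKernel_neg (hZ : Module.finrank ℝ Z = 2) (hα : -2 ≤ α)
    (h1 : α + 4 < Module.finrank ℝ X) (h2 : Module.finrank ℝ X < α + 6) :
    ∃ a : ℝ, 0 < a ∧ ∃ ε : ℝ, 0 < ε ∧ ∫ x : X × Z, scaledKernel α ε ‖x.1‖ ‖x.2‖ *
      (Real.exp (-a * ‖x.1‖ ^ 2) * heatDifference ‖x.2‖) < 0 := by
  obtain ⟨a, ha, hneg⟩ := exists_integral_scaledKernel_zero_neg (X := X) (Z := Z) hZ h1 h2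
  refine ⟨a, ha, ?_⟩
  have hB1 := integrable_norm_rpow_mul_exp_mul_heatDifference (X := X) (Z := Z) (β := α + 2)
    (by linarith) ha 0
  have hB2 := integrable_norm_rpow_mul_exp_mul_heatDifference (X := X) (Z := Z) (β := 2)
    (by linarith) ha 2
  simp only [pow_zero, mul_one] at hB1
  have hlim : Tendsto (fun ε : ℝ => ∫ x : X × Z, scaledKernel α ε ‖x.1‖ ‖x.2‖ *
      (Real.exp (-a * ‖x.1‖ ^ 2) * heatDifference ‖x.2‖)) (𝓝[>] 0)
      (𝓝 (∫ x : X × Z, scaledKernel α 0 ‖x.1‖ ‖x.2‖ *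
        (Real.exp (-a * ‖x.1‖ ^ 2) * heatDifference ‖x.2‖))) := by
    refine tendsto_integral_filter_of_dominated_convergence _ ?_ ?_ (hB1.norm.add hB2.norm) ?_
    · refine Eventually.of_forall fun ε => Measurable.aestronglyMeasurable ?_
      have := continuous_heatDifference.measurable
      exact (measurable_scaledKernel_norm ε).mul (by fun_prop)
    · filter_upwards [Ioo_mem_nhdsGT one_pos] with ε hε
      filter_upwards [ae_fst_ne_zero] with x hx
      have hr := norm_pos_iff.2 hx
      simp only [Pi.add_apply]
      rw [norm_mul, norm_mul _ (_ * _), norm_mul (_ * (_ * _)), ← add_mul,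
        Real.norm_of_nonneg (scaledKernel_nonneg _ _ _ _),
        Real.norm_of_nonneg (by positivity : 0 ≤ ‖x.1‖ ^ (-(α + 2))),
        Real.norm_of_nonneg (by positivity :
          0 ≤ ‖x.1‖ ^ (-2 : ℝ) * ((1 + ‖x.1‖) ^ 2 * (1 + ‖x.2‖) ^ 2))]
      exact mul_le_mul_of_nonneg_right (scaledKernel_le hα hε hr (norm_nonneg _)) (norm_nonneg _)
    · filter_upwards [ae_fst_ne_zero] with x hx
      exact (tendsto_scaledKernel α (norm_pos_iff.2 hx) _).mul_const _
  obtain ⟨ε, hε, hε0⟩ := ((hlim.eventually (gt_mem_nhds hneg)).and self_mem_nhdsWithin).exists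
  exact ⟨ε, hε0, hε⟩

theorem exists_integral_quartic_neg (hZ : Module.finrank ℝ Z = 2) (hα : -2 ≤ α)
    (h1 : α + 4 < Module.finrank ℝ X) (h2 : Module.finrank ℝ X < α + 6) :
    ∃ a : ℝ, 0 < a ∧ ∃ ε : ℝ, 0 < ε ∧ ∫ x : X × Z, (‖x.1‖ ^ 2 + ‖x.2‖ ^ 2) ^ (-α / 2) *
      (√((‖x.1‖ ^ 2 + ‖x.2‖ ^ 2) ^ 2 + (ε⁻¹) ^ 4 * ‖x.2‖ ^ 4))⁻¹ *
      (Real.exp (-a * ‖x.1‖ ^ 2) * heatDifference (ε⁻¹ * ‖x.2‖)) < 0 := by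
  obtain ⟨a, ha, ε, hε, hneg⟩ := exists_integral_scaledKernel_neg (X := X) (Z := Z) hZ hα h1 h2
  refine ⟨a, ha, ε, hε, ?_⟩
  obtain ⟨c, hc, h⟩ := integral_comp_smul_snd (X := X) (Z := Z) (fun x : X × Z =>
    (‖x.1‖ ^ 2 + ‖x.2‖ ^ 2) ^ (-α / 2) *
      (√((‖x.1‖ ^ 2 + ‖x.2‖ ^ 2) ^ 2 + (ε⁻¹) ^ 4 * ‖x.2‖ ^ 4))⁻¹ *
      (Real.exp (-a * ‖x.1‖ ^ 2) * heatDifference (ε⁻¹ * ‖x.2‖))) hε.ne'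
  have heq (x : X × Z) : (‖x.1‖ ^ 2 + ‖ε • x.2‖ ^ 2) ^ (-α / 2) *
      (√((‖x.1‖ ^ 2 + ‖ε • x.2‖ ^ 2) ^ 2 + (ε⁻¹) ^ 4 * ‖ε • x.2‖ ^ 4))⁻¹ *
      (Real.exp (-a * ‖x.1‖ ^ 2) * heatDifference (ε⁻¹ * ‖ε • x.2‖)) =
      scaledKernel α ε ‖x.1‖ ‖x.2‖ * (Real.exp (-a * ‖x.1‖ ^ 2) * heatDifference ‖x.2‖) := by
    rw [norm_smul, Real.norm_of_nonneg hε.le, scaledKernel, mul_pow, mul_pow, ← mul_assoc (ε⁻¹),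
      ← mul_assoc (ε⁻¹ ^ 4), ← mul_pow, ← mul_pow, inv_mul_cancel₀ hε.ne', one_pow, one_mul, one_mul]
  simp only [heq] at h
  rw [h] at hneg
  exact (pos_iff_neg_of_mul_neg hneg).1 hc

end Limits

section Coordinates

variable {ι : Type*} [Fintype ι]

/-- The restriction of a vector to the coordinates that satisfy `q`. -/
noncomputable def coordRestrict (q : ι → Prop) [DecidablePred q] :
    EuclideanSpace ℝ ι →L[ℝ] EuclideanSpace ℝ {i // q i} :=
  LinearMap.toContinuousLinearMap
    { toFun := fun x => WithLp.toLp 2 fun i => x i.1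
      map_add' := fun _ _ => rfl
      map_smul' := fun _ _ => rfl }

variable (q : ι → Prop) [DecidablePred q]

theorem norm_sq_coordRestrict (x : EuclideanSpace ℝ ι) :
    ‖coordRestrict q x‖ ^ 2 = ∑ i : {i // q i}, x i.1 ^ 2 := by
  rw [EuclideanSpace.norm_sq_eq]
  refine Finset.sum_congr rfl fun i _ => ?_
  rw [Real.norm_eq_abs, sq_abs]
  rfl

theorem norm_sq_coordRestrict_add (x : EuclideanSpace ℝ ι) :
    ‖coordRestrict q x‖ ^ 2 + ‖coordRestrict (fun i => ¬ q i) x‖ ^ 2 = ‖x‖ ^ 2 := by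
  rw [norm_sq_coordRestrict, norm_sq_coordRestrict, EuclideanSpace.norm_sq_eq,
    ← Fintype.sum_subtype_add_sum_subtype q]
  simp only [Real.norm_eq_abs, sq_abs]

theorem integral_comp_coordRestrict (F : EuclideanSpace ℝ {i // q i} ×
    EuclideanSpace ℝ {i // ¬ q i} → ℝ) :
    ∫ x : EuclideanSpace ℝ ι, F (coordRestrict q x, coordRestrict (fun i => ¬ q i) x) =
      ∫ y, F y := by
  let e := ((MeasurableEquiv.toLp 2 (ι → ℝ)).symm.trans
    (MeasurableEquiv.piEquivPiSubtypeProd (fun _ => ℝ) q)).trans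
    ((MeasurableEquiv.toLp 2 ({i // q i} → ℝ)).prodCongr
      (MeasurableEquiv.toLp 2 ({i // ¬ q i} → ℝ)))
  have he : MeasurePreserving e :=
    ((EuclideanSpace.volume_preserving_symm_measurableEquiv_toLp ι).trans
      (volume_preserving_piEquivPiSubtypeProd (fun _ => ℝ) q)).trans
      ((PiLp.volume_preserving_toLp _).prod (PiLp.volume_preserving_toLp _))
  exact he.integral_comp' F

theorem exists_convolution_conjReflect_eq (hcard : Fintype.card {i // ¬ q i} = 2) {a δ : ℝ}
    (ha : 0 < a) (hδ : 0 < δ) : ∃ φ : 𝓢(EuclideanSpace ℝ ι, ℂ), ∃ κ : ℝ, 0 < κ ∧ ∀ x,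
      SchwartzMap.convolution (ContinuousLinearMap.mul ℂ ℂ) φ (conjReflect φ) x =
        ((κ * (Real.exp (-a * ‖coordRestrict q x‖ ^ 2) *
          heatDifference (δ * ‖coordRestrict (fun i => ¬ q i) x‖)) : ℝ) : ℂ) := by
  let c (b : ℝ) (i : ι) : ℝ := if q i then 2 * a else b
  have hc {b : ℝ} (hb : 0 < b) (i : ι) : 0 < c b i := by
    by_cases h : q i <;> simp [c, h, ha, hb]
  have hsum (x : EuclideanSpace ℝ ι) (b b' : ℝ) :
      -∑ i, c b i * c b' i / (c b i + c b' i) * x i ^ 2 = -a * ‖coordRestrict q x‖ ^ 2 +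
        -(b * b' / (b + b')) * ‖coordRestrict (fun i => ¬ q i) x‖ ^ 2 := by
    rw [norm_sq_coordRestrict, norm_sq_coordRestrict, ← Fintype.sum_subtype_add_sum_subtype q,
      neg_add, neg_mul, neg_mul, Finset.mul_sum, Finset.mul_sum]
    congr 2 <;> refine Finset.sum_congr rfl fun i _ => ?_
    · simp only [c, i.2, if_true]
      congr 1
      field_simp
      ring
    · simp only [c, i.2, if_false]
  let κ₀ : ℝ := ∏ _i : {i // q i}, √(Real.pi / (2 * a + 2 * a))
  have hκ₀ : 0 < κ₀ := Finset.prod_pos fun _ _ => by positivity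
  have hprod {b b' : ℝ} (hb : 0 < b) (hb' : 0 < b') :
      ∏ i, √(Real.pi / (c b i + c b' i)) = κ₀ * (Real.pi / (b + b')) := by
    rw [← Fintype.prod_subtype_mul_prod_subtype q]
    congr 1
    · refine Finset.prod_congr rfl fun i _ => ?_
      simp only [c, i.2, if_true]
    · rw [Finset.prod_congr rfl (g := fun _ => √(Real.pi / (b + b'))) fun i _ => by
        simp only [c, i.2, if_false], Finset.prod_const, Finset.card_univ, hcard,
        Real.sq_sqrt (by positivity)]
  have h1 : 0 < 2 * δ ^ 2 := by positivity
  have h2 : 0 < 2 / 3 * δ ^ 2 := by positivity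
  let Γ₁ := diagGaussian (c (2 * δ ^ 2)) (hc h1)
  let Γ₂ := diagGaussian (c (2 / 3 * δ ^ 2)) (hc h2)
  let φ := ((2 * δ ^ 2 : ℝ) : ℂ) • Γ₁ - ((2 / 3 * δ ^ 2 : ℝ) : ℂ) • Γ₂
  have hφ : conjReflect φ = φ := by
    ext x
    have e1 : (starRingEnd ℂ) (Γ₁ (-x)) = Γ₁ x :=
      congrArg (fun f : 𝓢(EuclideanSpace ℝ ι, ℂ) => f x) (conjReflect_diagGaussian (hc h1))
    have e2 : (starRingEnd ℂ) (Γ₂ (-x)) = Γ₂ x :=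
      congrArg (fun f : 𝓢(EuclideanSpace ℝ ι, ℂ) => f x) (conjReflect_diagGaussian (hc h2))
    rw [conjReflect_apply]
    simp only [φ, sub_apply, smul_apply, smul_eq_mul, map_sub, map_mul,
      Complex.conj_ofReal, e1, e2]
  refine ⟨φ, κ₀ * Real.pi * δ ^ 2, by positivity, fun x => ?_⟩
  rw [hφ]
  simp only [φ, Γ₁, Γ₂, map_sub, map_smul, sub_apply, smul_apply, smul_eq_mul, convolution_diagGaussian_apply, hsum, hprod h1 h1,
    hprod h1 h2, hprod h2 h1, hprod h2 h2, Real.exp_add]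
  norm_cast
  set r := ‖coordRestrict q x‖
  set s := ‖coordRestrict (fun i => ¬ q i) x‖
  have hδ2 : δ ^ 2 ≠ 0 := by positivity
  have e11 : -(2 * δ ^ 2 * (2 * δ ^ 2) / (2 * δ ^ 2 + 2 * δ ^ 2)) * s ^ 2 = -1 * (δ * s) ^ 2 := by
    field_simp; ring
  have e12 : -(2 * δ ^ 2 * (2 / 3 * δ ^ 2) / (2 * δ ^ 2 + 2 / 3 * δ ^ 2)) * s ^ 2 =
      -(1 / 2) * (δ * s) ^ 2 := by
    field_simp; ring
  have e21 : -(2 / 3 * δ ^ 2 * (2 * δ ^ 2) / (2 / 3 * δ ^ 2 + 2 * δ ^ 2)) * s ^ 2 =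
      -(1 / 2) * (δ * s) ^ 2 := by
    field_simp; ring
  have e22 : -(2 / 3 * δ ^ 2 * (2 / 3 * δ ^ 2) / (2 / 3 * δ ^ 2 + 2 / 3 * δ ^ 2)) * s ^ 2 =
      -(1 / 3) * (δ * s) ^ 2 := by
    field_simp; ring
  rw [e11, e12, e21, e22, heatDifference]
  field_simp
  ring

end Coordinates

section Witness

variable {n : ℕ}

theorem norm_coordRestrict_rotate (p : Fin n → Prop) [DecidablePred p] (θ : ℝ) (x : Space n) :
    ‖coordRestrict (fun k : Fin n × Fin 2 => p k.1) (rotate θ x)‖ =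
      ‖coordRestrict (fun k : Fin n × Fin 2 => p k.1) x‖ := by
  have h (y : Space n) : ‖coordRestrict (fun k : Fin n × Fin 2 => p k.1) y‖ ^ 2 =
      ∑ i, if p i then y (i, 0) ^ 2 + y (i, 1) ^ 2 else 0 := by
    rw [norm_sq_coordRestrict, ← Finset.sum_subtype (Finset.univ.filter fun k => p k.1)
      (by simp) (fun k => y k ^ 2), Finset.sum_filter, Fintype.sum_prod_type]
    refine Finset.sum_congr rfl fun i _ => ?_
    rw [Fin.sum_univ_two]
    split_ifs <;> simp
  refine (sq_eq_sq₀ (norm_nonneg _) (norm_nonneg _)).1 ?_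
  rw [h, h]
  refine Finset.sum_congr rfl fun i _ => ?_
  split_ifs
  · simp only [rotate, if_true, one_ne_zero, if_false]
    linear_combination (x (i, 0) ^ 2 + x (i, 1) ^ 2) * Real.sin_sq_add_cos_sq θ
  · rfl

theorem norm_rotate (θ : ℝ) (x : Space n) : ‖rotate θ x‖ = ‖x‖ := by
  refine (sq_eq_sq₀ (norm_nonneg _) (norm_nonneg _)).1 ?_
  rw [← norm_sq_coordRestrict_add (fun _ => True), ← norm_sq_coordRestrict_add (fun _ => True) x,
    norm_coordRestrict_rotate (fun _ => True), norm_coordRestrict_rotate (fun _ => ¬ True)]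

theorem isRotationInvariant_quarticBody {M : ℝ} (hM : 0 ≤ M) (p : Fin n → Prop)
    [DecidablePred p] : IsRotationInvariant
      (quarticBody M (coordRestrict (fun k : Fin n × Fin 2 => p k.1))) := by
  intro θ x
  rw [gauge_quarticBody hM, gauge_quarticBody hM, quarticForm, quarticForm,
    norm_coordRestrict_rotate, norm_rotate]

theorem norm_rpow_mul_gauge_quarticBody {E F : Type*} [NormedAddCommGroup E]
    [InnerProductSpace ℝ E] [NormedAddCommGroup F] [InnerProductSpace ℝ F] {M : ℝ} (hM : 0 ≤ M)
    (A : E →L[ℝ] F) (α : ℝ) (x : E) :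
    ‖x‖ ^ (-α) * gauge (quarticBody M A) x ^ (-2 : ℝ) =
      (‖x‖ ^ 2) ^ (-α / 2) * (√((‖x‖ ^ 2) ^ 2 + M * ‖A x‖ ^ 4))⁻¹ := by
  have h1 : (‖x‖ ^ 2) ^ (-α / 2) = ‖x‖ ^ (-α) := by
    rw [← Real.rpow_natCast, ← Real.rpow_mul (norm_nonneg x)]
    congr 1
    push_cast
    ring
  have hP := quarticForm_nonneg (A := A) hM x
  rw [h1, gauge_quarticBody hM, ← Real.rpow_mul hP, ← pow_mul, Real.sqrt_eq_rpow,
    ← Real.rpow_neg (by positivity), quarticForm]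
  norm_num

theorem exists_isGivenBy_quarticBody {E F : Type*} [NormedAddCommGroup E] [InnerProductSpace ℝ E]
    [FiniteDimensional ℝ E] [Nontrivial E] [MeasurableSpace E] [BorelSpace E]
    [NormedAddCommGroup F] [InnerProductSpace ℝ F] {M : ℝ} (hM : 0 ≤ M) (A : E →L[ℝ] F) {α : ℝ}
    (hα : α + 2 < Module.finrank ℝ E) :
    ∃ T : 𝓢'(E, ℂ),
      IsGivenBy T fun x => ‖x‖ ^ (-α) * gauge (quarticBody M A) x ^ (-2 : ℝ) := by
  simp only [norm_rpow_mul_gauge_quarticBody hM]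
  refine exists_isGivenBy ?_ (fun x => by positivity) hα fun x => ?_
  · have h : Continuous fun x => √((‖x‖ ^ 2) ^ 2 + M * ‖A x‖ ^ 4) := by fun_prop
    exact ((measurable_norm.pow_const 2).pow_const _).mul h.measurable.inv
  · rw [← norm_rpow_mul_gauge_quarticBody hM]
    rcases eq_or_ne x 0 with rfl | hx
    · rw [gauge_zero, Real.zero_rpow (by norm_num), mul_zero]
      positivity
    · have hx' := norm_pos_iff.2 hx
      rw [neg_add, Real.rpow_add hx']
      refine mul_le_mul_of_nonneg_left (Real.rpow_le_rpow_of_nonpos hx' ?_ (by norm_num))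
        (by positivity)
      rw [gauge_quarticBody hM]
      calc ‖x‖ = (‖x‖ ^ 4) ^ (1 / 4 : ℝ) := by
            rw [← Real.rpow_natCast, ← Real.rpow_mul hx'.le]
            norm_num
        _ ≤ _ := Real.rpow_le_rpow (by positivity) (norm_pow_four_le_quarticForm hM x)
            (by norm_num)

theorem not_isPositiveDefinite_of_quartic {ι : Type*} [Fintype ι] (q : ι → Prop)
    [DecidablePred q] (hcard : Fintype.card {i // ¬ q i} = 2) {α : ℝ} (hα : -2 ≤ α)
    (h1 : α + 4 < Fintype.card {i // q i}) (h2 : Fintype.card {i // q i} < α + 6) :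
    ∃ M : ℝ, 0 ≤ M ∧ ∀ T : 𝓢'(EuclideanSpace ℝ ι, ℂ),
      IsGivenBy T (fun x => ‖x‖ ^ (-α) *
        gauge (quarticBody M (coordRestrict fun i => ¬ q i)) x ^ (-2 : ℝ)) →
      ¬ IsPositiveDefinite T := by
  have hX : Module.finrank ℝ (EuclideanSpace ℝ {i // q i}) = Fintype.card {i // q i} :=
    finrank_euclideanSpace
  have hZ : Module.finrank ℝ (EuclideanSpace ℝ {i // ¬ q i}) = 2 := by
    rw [finrank_euclideanSpace, hcard]
  have : Nontrivial (EuclideanSpace ℝ {i // q i}) := by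
    apply Module.nontrivial_of_finrank_pos (R := ℝ)
    have : (0 : ℝ) < Fintype.card {i // q i} := by linarith
    rw [hX]
    exact_mod_cast this
  have : Nontrivial (EuclideanSpace ℝ {i // ¬ q i}) := by
    apply Module.nontrivial_of_finrank_pos (R := ℝ)
    rw [hZ]
    norm_num
  obtain ⟨a, ha, ε, hε, hneg⟩ := exists_integral_quartic_neg (α := α) hZ hα (hX ▸ h1) (hX ▸ h2)
  have hM : 0 ≤ (ε⁻¹) ^ 4 := by positivity
  refine ⟨(ε⁻¹) ^ 4, hM, fun T hT hpd => ?_⟩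
  obtain ⟨φ, κ, hκ, hφ⟩ := exists_convolution_conjReflect_eq q hcard ha (inv_pos.2 hε)
  have h := hpd φ
  rw [(hT _).2] at h
  simp only [hφ, norm_rpow_mul_gauge_quarticBody hM, ← Complex.ofReal_mul] at h
  rw [integral_complex_ofReal, Complex.zero_le_real] at h
  rw [← integral_comp_coordRestrict q] at hneg
  simp only [norm_sq_coordRestrict_add] at hneg
  simp only [mul_left_comm _ κ] at h
  rw [integral_const_mul] at h
  exact absurd (nonneg_of_mul_nonneg_right h hκ) (not_le.2 hneg)

end Witness

end ComplexBP

theorem mainTheorem3 (n : ℕ) (hn : 3 ≤ n) (α : ℝ)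
    (hα : α ∈ Set.Ioo (2 * (n : ℝ) - 7) (2 * (n : ℝ) - 6)) :
    ∃ L : Set (ComplexBP.Space n),
      ComplexBP.IsSymmetricConvexBody L ∧
      ComplexBP.IsInfinitelySmooth L ∧
      ComplexBP.HasPositiveCurvature L ∧
      ComplexBP.IsRotationInvariant L ∧
      ∃ T : 𝓢'(ComplexBP.Space n, ℂ),
        ComplexBP.IsGivenBy T (fun x => ‖x‖ ^ (-α) * gauge L x ^ (-2 : ℝ)) ∧
        ¬ ComplexBP.IsPositiveDefinite T := by
  obtain ⟨hα1, hα2⟩ := hα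
  have hn' : (3 : ℝ) ≤ n := by exact_mod_cast hn
  let i₀ : Fin n := ⟨0, by omega⟩
  let q : Fin n × Fin 2 → Prop := fun k => k.1 ≠ i₀
  have hcard : Fintype.card {k // ¬ q k} = 2 := by
    refine (Fintype.card_congr (β := Fin 2) ⟨fun k => k.1.2, fun j => ⟨(i₀, j), by simp [q]⟩, ?_,
      fun _ => rfl⟩).trans (Fintype.card_fin 2)
    rintro ⟨⟨i, j⟩, h⟩
    simpa [q, eq_comm] using h
  have hcard' : (Fintype.card {k // q k} : ℝ) = 2 * n - 2 := by
    have h := Fintype.card_subtype_compl q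
    have hle := Fintype.card_subtype_le q
    rw [hcard, Fintype.card_prod, Fintype.card_fin, Fintype.card_fin] at h
    rw [Fintype.card_prod, Fintype.card_fin, Fintype.card_fin] at hle
    have h' : Fintype.card {k // q k} + 2 = n * 2 := by omega
    have h'' : (Fintype.card {k // q k} : ℝ) + 2 = n * 2 := by exact_mod_cast h'
    linarith
  obtain ⟨M, hM, hT⟩ := ComplexBP.not_isPositiveDefinite_of_quartic q hcard (α := α)
    (by linarith) (by linarith) (by linarith)
  have hdim : (Module.finrank ℝ (ComplexBP.Space n) : ℝ) = 2 * n := by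
    rw [finrank_euclideanSpace, Fintype.card_prod, Fintype.card_fin, Fintype.card_fin]
    push_cast
    ring
  have : Nontrivial (ComplexBP.Space n) := by
    apply Module.nontrivial_of_finrank_pos (R := ℝ)
    have : (0 : ℝ) < Module.finrank ℝ (ComplexBP.Space n) := by linarith
    exact_mod_cast this
  obtain ⟨T, hTf⟩ := ComplexBP.exists_isGivenBy_quarticBody hM
    (ComplexBP.coordRestrict fun k => ¬ q k) (α := α) (by linarith)
  exact ⟨ComplexBP.quarticBody M (ComplexBP.coordRestrict fun k => ¬ q k),
    ComplexBP.isSymmetricConvexBody_quarticBody hM, ComplexBP.isInfinitelySmooth_quarticBody hM,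
    ComplexBP.hasPositiveCurvature_quarticBody hM,
    ComplexBP.isRotationInvariant_quarticBody hM (fun i => ¬ i ≠ i₀), T, hTf, hT T hTf⟩
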